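/- Consider a cognitive radio network with one primary source, a primary destination, a secondary destination, and $M\ge 3$ secondary users, one of which, $v$, is scheduled to transmit its own packet in the current slot, while the other $M-1$ act as relays. There is no direct link from the primary source to the primary destination. All channel coefficients (primary source to users, $h_{\mathrm p,k}$; users to primary destination, $h_{k,\mathrm{pd}}$; users to secondary destination, $h_{k,\mathrm{sd}}$) are i.i.d. $\mathcal{CN}(0,1)$. The noise power is $N_0>0$, the power used for primary packets is $P$ (both by the primary source and, in total, by the relays), the power of $v$ for its own packet is $P_{\mathrm s}>0$, and $\gamma=P/N_0$; $N_0$ and $P_{\mathrm s}$ are fixed while $\gamma\to\infty$. The slot is split into fractions $\zeta$ and $1-\zeta$, with $0<\zeta<1$. With data rate $R$ (bits/s/Hz over the whole slot), the primary source transmits at rate $R/\zeta$ in the first part, and the set of decoding relays is $\Lambda=\{k\ne v:\ \log_2(1+\gamma|h_{\mathrm p,k}|^2)\ge R/\zeta\}$. If $|\Lambda|\ge 2$, the relays in $\Lambda$ forward the packet at rate $R/(1-\zeta)$ in the second part, with the zero-forcing beamformer that maximizes $|g^\dagger h_{\mathrm{pd}}|^2$ subject to $g^\dagger h_{\mathrm{sd}}=0$,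 $\|g\|=1$ (with $h_{\mathrm{pd}}=(h_{k,\mathrm{pd}})_{k\in\Lambda}$ and $h_{\mathrm{sd}}=(h_{k,\mathrm{sd}})_{k\in\Lambda}$), while $v$ transmits its own packet, so that $$\mathrm{SINR}=\frac{|g^\dagger h_{\mathrm{pd}}|^2P}{N_0+P_{\mathrm s}|h_{v,\mathrm{pd}}|^2}.$$ A primary outage occurs if $|\Lambda|<2$, or if $|\Lambda|\ge2$ and $\log_2(1+\mathrm{SINR})<R/(1-\zeta)$. Let $\nu(\gamma)$ be its probability when the data rate is $R=R(\gamma)$. Data rates are assumed to be bounded below by a positive constant for all large $\gamma$. The rate $R(\cdot)$ has multiplexing gain $r$ if $\lim_{\gamma\to\infty}R(\gamma)/\log_2\gamma=r$, and the diversity gain is $d$ if $\nu(\gamma)>0$ for all large $\gamma$ and $\lim_{\gamma\to\infty}\log\nu(\gamma)/\log\gamma=-d$. Then: 1. For every fixed data rate $R>0$, the outage probability decays with exponent $M-2$: $\nu(\gamma)=\Theta(\gamma^{-(M-2)})$ as $\gamma\to\infty$. 2. For every $0\le r\le\min\{\zeta,1-\zeta\}$ and every data rate with multiplexing gain $r$,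 the diversity gain is $$d(r)=\Bigl(1-\max\Bigl\{\frac1\zeta,\frac1{1-\zeta}\Bigr\}\,r\Bigr)(M-2).$$ 3. The maximum diversity gain, over all data rates that have a multiplexing gain, is $M-2$, and it is attained. 4. The maximum multiplexing gain, i.e. the supremum of the multiplexing gains of data rates that have a positive diversity gain, is $\min\{\zeta,1-\zeta\}$. -/

import Mathlib

open MeasureTheory ProbabilityTheory Filter Topology
open scoped ENNReal NNReal

noncomputable section

namespace CoopRelay

/-- The circularly symmetric complex Gaussian law `CN(0,1)` on `ℂ`: the real and the imaginary
part are independent real Gaussians with mean `0` and variance `1/2`. -/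
def stdComplexGaussian : Measure ℂ :=
  ((gaussianReal 0 (1 / 2)).prod (gaussianReal 0 (1 / 2))).map
    (fun p : ℝ × ℝ => (⟨p.1, p.2⟩ : ℂ))

/-- The wireless links that matter when the primary direct link is disconnected. The `M` secondary
users are indexed by `Fin M`. -/
inductive Link (M : ℕ) where
  /-- primary source to secondary user `k` -/
  | fromPrimary (k : Fin M)
  /-- secondary user `k` to the primary destination -/
  | toPrimaryDest (k : Fin M)
  /-- secondary user `k` to the secondary destination -/
  | toSecondaryDest (k : Fin M)

/-- Rayleigh block fading in one slot: the channel coefficients are independent random variables,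
each with law `CN(0,1)`. -/
structure IsRayleigh {Ω : Type*} [MeasurableSpace Ω] (μ : Measure Ω) {M : ℕ}
    (h : Link M → Ω → ℂ) : Prop where
  measurable : ∀ l, Measurable (h l)
  law : ∀ l, μ.map (h l) = stdComplexGaussian
  indep : iIndepFun h μ

/-- The set of admissible zero-forcing weight vectors: unit vectors `g` with `g† hsd = 0`.
(`inner ℂ g y` is `g† y`.) -/
def zfFeasible {ι : Type*} [Fintype ι] (hsd : EuclideanSpace ℂ ι) : Set (EuclideanSpace ℂ ι) :=
  {g | ‖g‖ = 1 ∧ inner ℂ g hsd = 0}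

/-- The channel gain of the optimal zero-forcing beamformer: the value of the problem
`max |g† hpd|²` subject to `g† hsd = 0` and `‖g‖ = 1`. It is used only with at least two relays,
where the admissible set is compact and nonempty, so that the supremum is a maximum. -/
def zfGain {ι : Type*} [Fintype ι] (hpd hsd : EuclideanSpace ℂ ι) : ℝ :=
  sSup ((fun g => ‖inner ℂ g hpd‖ ^ 2) '' zfFeasible hsd)

section Protocol

variable {M : ℕ}

/-- The decoding set `Λ` for a realization `h` of the channels when user `v` is scheduled for its
own transmission: the other users `k` whose capacity `log₂ (1 + (P / N₀) |h_{p,k}|²)` is at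
least the rate `R / ζ` at which the primary source transmits during the fraction `ζ`. -/
def decodingSet (h : Link M → ℂ) (v : Fin M) (N₀ ζ P R : ℝ) : Finset (Fin M) :=
  open Classical in
  Finset.univ.filter fun k =>
    k ≠ v ∧ R / ζ ≤ Real.logb 2 (1 + P / N₀ * ‖h (.fromPrimary k)‖ ^ 2)

/-- The signal-to-interference-plus-noise ratio at the primary destination when the relays in `Λ`
forward the primary packet with the optimal zero-forcing beamformer and total power `P`, while
user `v` transmits its own packet with power `Ps`. -/
def sinr (h : Link M → ℂ) (v : Fin M) (Λ : Finset (Fin M)) (N₀ Ps P : ℝ) : ℝ :=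
  zfGain (WithLp.toLp 2 fun k : Λ => h (.toPrimaryDest k))
      (WithLp.toLp 2 fun k : Λ => h (.toSecondaryDest k)) * P /
    (N₀ + Ps * ‖h (.toPrimaryDest v)‖ ^ 2)

/-- Primary outage (no direct link): fewer than two relays decode the packet, or at least two
relays decode it but the primary destination cannot decode the transmission of the relays, which
has rate `R / (1 - ζ)`. -/
def IsOutage (h : Link M → ℂ) (v : Fin M) (N₀ Ps ζ P R : ℝ) : Prop :=
  (decodingSet h v N₀ ζ P R).card < 2 ∨
    (2 ≤ (decodingSet h v N₀ ζ P R).card ∧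
      Real.logb 2 (1 + sinr h v (decodingSet h v N₀ ζ P R) N₀ Ps P) < R / (1 - ζ))

/-- The primary outage probability `ν(γ)` at average signal-to-noise ratio `γ = P / N₀` when the
data rate at that signal-to-noise ratio is `R γ` (in bits/s/Hz, over the whole slot). -/
def outageProb {Ω : Type*} [MeasurableSpace Ω] (μ : Measure Ω) (h : Link M → Ω → ℂ)
    (v : Fin M) (N₀ Ps ζ : ℝ) (R : ℝ → ℝ) (γ : ℝ) : ℝ :=
  μ.real {ω | IsOutage (fun l => h l ω) v N₀ Ps ζ (γ * N₀) (R γ)}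

end Protocol

/-- A data rate, as a function of the signal-to-noise ratio, that does not degenerate to zero. -/
def IsDataRate (R : ℝ → ℝ) : Prop :=
  ∃ c > 0, ∀ᶠ γ in atTop, c ≤ R γ

/-- The data rate `R` (in bits/s/Hz) has multiplexing gain `r`. -/
def HasMultiplexingGain (R : ℝ → ℝ) (r : ℝ) : Prop :=
  Tendsto (fun γ => R γ / Real.logb 2 γ) atTop (𝓝 r)

/-- The outage probability `ν` has diversity gain `d`. -/
def HasDiversityGain (ν : ℝ → ℝ) (d : ℝ) : Prop :=
  (∀ᶠ γ in atTop, 0 < ν γ) ∧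
    Tendsto (fun γ => Real.log (ν γ) / Real.log γ) atTop (𝓝 (-d))

end CoopRelay

end

/-! Put `q = max (1/ζ) (1/(1-ζ))` and `t = (2^(qR) - 1)/γ`. Everything follows from one two-sided
estimate, `exists_outageProb_bounds`: up to constants, the outage probability lies between `min t 1
^ (M-2)` and `t ^ (M-2)`.

The zero-forcing gain is the squared distance from `h_pd` to the line spanned by `h_sd`. For the
upper bound, suppose the second hop fails and let `j` be the decoding relay with largest
`|h_{j,sd}|`. Eliminating the unknown multiplier of `h_sd` with the help of relay `j` puts
`h_{k,pd}` near `(h_{j,pd}/h_{j,sd}) h_{k,sd}` for every other decoding relay `k`, while every relay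
that failed to decode has a small source link. If instead at most one relay decodes, `M-2` source
links are small. In each case `M-2` coefficients lie in balls of squared radius of order `t` times
an interference factor, with centres and radii that depend on other coefficients only
(`exists_criticalLinks_of_isOutage`). Integrating these coordinates out one at a time costs a factor
of order `t` each. The interference factor has finite moments, and a union bound over the finitely
many configurations finishes the estimate.

For the lower bound, each hop alone produces an outage of the right order: all relays but one fade
on the first hop, or `h_pd` is nearly parallel to `h_sd` on the second. The hop with the larger
threshold is used.

Since `R` is bounded below, `log t / log γ` tends to `qr - 1`, which gives the tradeoff. The lower
bound alone gives `d ≤ (M-2) max (1-qr) 0`, which settles both maxima. -/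

namespace CoopRelay

/-! ### Iterated integration over coordinates of a product measure -/

section Product

variable {ι X : Type*} [Fintype ι] [DecidableEq ι] [MeasurableSpace X]

/-- Fubini in the single coordinate `i`: `F` is constant along it, and since `ν` has mass one, a
function already averaged over that coordinate is unchanged by averaging again. -/
theorem lintegral_pi_mul_eq_of_update (ν : Measure X) [IsProbabilityMeasure ν] (i : ι)
    {F G : (ι → X) → ℝ≥0∞} (hF : Measurable F) (hG : Measurable G)
    (hFi : ∀ x z, F (Function.update x i z) = F x) :
    ∫⁻ x, F x * G x ∂Measure.pi (fun _ => ν) =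
      ∫⁻ x, F x * ∫⁻ z, G (Function.update x i z) ∂ν ∂Measure.pi (fun _ => ν) := by
  have hmG : Measurable fun x : ι → X => ∫⁻ z, G (Function.update x i z) ∂ν := by
    have := hG.lmarginal (fun _ : ι => ν) (s := {i})
    rwa [lmarginal_singleton] at this
  refine lintegral_eq_of_lmarginal_eq {i} (hF.mul hG) (hF.mul hmG) ?_
  rw [lmarginal_singleton, lmarginal_singleton]
  funext x
  simp only [hFi, Function.update_idem]
  have hm : Measurable fun z => G (Function.update x i z) := hG.comp (measurable_update x)
  rw [lintegral_const_mul _ hm, lintegral_const, measure_univ, mul_one]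

/-- Conditional independence given the coordinates outside `T`. Once coordinate `i` has been
integrated out of `G i`, the resulting factor depends on no coordinate in `T`, so it can be absorbed
into `F`; this is why the induction runs over all `F`. -/
theorem lintegral_pi_mul_prod_eq_of_update (ν : Measure X) [IsProbabilityMeasure ν]
    {G : ι → (ι → X) → ℝ≥0∞} (hG : ∀ i, Measurable (G i)) (T : Finset ι)
    (hGT : ∀ i ∈ T, ∀ j ∈ T, j ≠ i → ∀ x z, G i (Function.update x j z) = G i x)
    {F : (ι → X) → ℝ≥0∞} (hF : Measurable F)
    (hFT : ∀ j ∈ T, ∀ x z, F (Function.update x j z) = F x) :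
    ∫⁻ x, F x * ∏ i ∈ T, G i x ∂Measure.pi (fun _ => ν) =
      ∫⁻ x, F x * ∏ i ∈ T, ∫⁻ z, G i (Function.update x i z) ∂ν ∂Measure.pi (fun _ => ν) := by
  induction T using Finset.induction_on generalizing F with
  | empty => simp
  | insert i T hi ih =>
    have hmG : Measurable fun x : ι → X => ∫⁻ z, G i (Function.update x i z) ∂ν := by
      have := (hG i).lmarginal (fun _ : ι => ν) (s := {i})
      rwa [lmarginal_singleton] at this
    have hne : ∀ j ∈ T, j ≠ i := fun j hj h => hi (h ▸ hj)
    simp only [Finset.prod_insert hi]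
    calc ∫⁻ x, F x * (G i x * ∏ j ∈ T, G j x) ∂Measure.pi (fun _ => ν)
        = ∫⁻ x, (F x * ∏ j ∈ T, G j x) * G i x ∂Measure.pi (fun _ => ν) := by
          congr 1; funext x; ring
      _ = ∫⁻ x, (F x * ∏ j ∈ T, G j x) * ∫⁻ z, G i (Function.update x i z) ∂ν
            ∂Measure.pi (fun _ => ν) := by
          refine lintegral_pi_mul_eq_of_update ν i
            (hF.mul (Finset.measurable_prod _ fun j _ => hG j)) (hG i) fun x z => ?_
          rw [hFT i (Finset.mem_insert_self _ _)]
          congr 1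
          exact Finset.prod_congr rfl fun j hj => hGT j (Finset.mem_insert_of_mem hj) i
            (Finset.mem_insert_self _ _) (hne j hj).symm x z
      _ = ∫⁻ x, (F x * ∫⁻ z, G i (Function.update x i z) ∂ν) * ∏ j ∈ T, G j x
            ∂Measure.pi (fun _ => ν) := by
          congr 1; funext x; ring
      _ = ∫⁻ x, (F x * ∫⁻ z, G i (Function.update x i z) ∂ν) *
            ∏ j ∈ T, ∫⁻ z, G j (Function.update x j z) ∂ν ∂Measure.pi (fun _ => ν) := by
          refine ih (fun k hk j hj => hGT k (Finset.mem_insert_of_mem hk) j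
            (Finset.mem_insert_of_mem hj)) (hF.mul hmG) fun j hj x z => ?_
          rw [hFT j (Finset.mem_insert_of_mem hj)]
          congr 2
          funext w
          rw [Function.update_comm (hne j hj), hGT i (Finset.mem_insert_self _ _) j
            (Finset.mem_insert_of_mem hj) (hne j hj)]
      _ = _ := by congr 1; funext x; ring

/-- The probability that the coordinates in `T` lie in balls whose centres and radii depend on
the other coordinates only. -/
theorem pi_forall_mem_closedBall_eq [PseudoMetricSpace X] [OpensMeasurableSpace X]
    [SecondCountableTopology X]
    (ν : Measure X) [IsProbabilityMeasure ν] (T : Finset ι) {A : Set (ι → X)}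
    (hA : MeasurableSet A) (hAT : ∀ j ∈ T, ∀ x z, Function.update x j z ∈ A ↔ x ∈ A)
    {c : ι → (ι → X) → X} (hc : ∀ i, Measurable (c i))
    (hcT : ∀ i ∈ T, ∀ j ∈ T, ∀ x z, c i (Function.update x j z) = c i x)
    {ρ : (ι → X) → ℝ} (hρ : Measurable ρ)
    (hρT : ∀ j ∈ T, ∀ x z, ρ (Function.update x j z) = ρ x) :
    Measure.pi (fun _ => ν) {x | x ∈ A ∧ ∀ i ∈ T, x i ∈ Metric.closedBall (c i x) (ρ x)} =
      ∫⁻ x in A, ∏ i ∈ T, ν (Metric.closedBall (c i x) (ρ x)) ∂Measure.pi (fun _ => ν) := by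
  classical
  set B : ι → Set (ι → X) := fun i => {x | x i ∈ Metric.closedBall (c i x) (ρ x)} with hB
  have hBm : ∀ i, MeasurableSet (B i) := fun i =>
    measurableSet_le ((measurable_pi_apply i).dist (hc i)) hρ
  have key := lintegral_pi_mul_prod_eq_of_update ν (G := fun i => (B i).indicator 1)
    (fun i => measurable_one.indicator (hBm i)) T (F := A.indicator 1) ?_
    (measurable_one.indicator hA) ?_
  · have h1 : ∀ x, A.indicator (1 : (ι → X) → ℝ≥0∞) x * ∏ i ∈ T, (B i).indicator 1 x =
        {x | x ∈ A ∧ ∀ i ∈ T, x i ∈ Metric.closedBall (c i x) (ρ x)}.indicator 1 x := by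
      intro x
      by_cases hx : x ∈ A
      · by_cases hT : ∀ i ∈ T, x ∈ B i
        · have hxT : x ∈ {x | x ∈ A ∧ ∀ i ∈ T, x i ∈ Metric.closedBall (c i x) (ρ x)} := ⟨hx, hT⟩
          rw [Set.indicator_of_mem hx, Set.indicator_of_mem hxT,
            Finset.prod_eq_one fun i hi => Set.indicator_of_mem (hT i hi) _]
          simp
        · rw [Set.indicator_of_notMem (s := {x | _}) (fun h => hT h.2)]
          push Not at hT
          obtain ⟨i, hi, hxi⟩ := hT
          rw [Finset.prod_eq_zero hi (Set.indicator_of_notMem hxi _), mul_zero]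
      · rw [Set.indicator_of_notMem hx, Set.indicator_of_notMem (s := {x | _}) (fun h => hx h.1),
          zero_mul]
    have hS : MeasurableSet {x | x ∈ A ∧ ∀ i ∈ T, x i ∈ Metric.closedBall (c i x) (ρ x)} := by
      have : {x | x ∈ A ∧ ∀ i ∈ T, x i ∈ Metric.closedBall (c i x) (ρ x)} =
          A ∩ ⋂ i ∈ T, B i := by ext x; simp [hB]
      rw [this]
      exact hA.inter (Finset.measurableSet_biInter _ fun i _ => hBm i)
    simp only [h1] at key
    rw [lintegral_indicator_one hS] at key
    rw [key, ← lintegral_indicator hA]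
    congr 1
    funext x
    by_cases hx : x ∈ A
    · rw [Set.indicator_of_mem hx, Set.indicator_of_mem hx, Pi.one_apply, one_mul]
      refine Finset.prod_congr rfl fun i hi => ?_
      have h2 : ∀ z, (B i).indicator (1 : (ι → X) → ℝ≥0∞) (Function.update x i z) =
          (Metric.closedBall (c i x) (ρ x)).indicator 1 z := by
        intro z
        simp only [Set.indicator_apply, hB, Set.mem_ofPred_eq, Function.update_self,
          hcT i hi i hi, hρT i hi, Pi.one_apply]
      simp only [h2]
      exact lintegral_indicator_one Metric.isClosed_closedBall.measurableSet
    · rw [Set.indicator_of_notMem hx, Set.indicator_of_notMem hx, zero_mul]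
  · intro i hi j hj hji x z
    simp only [Set.indicator_apply, hB, Set.mem_ofPred_eq, Function.update_of_ne hji.symm,
      hcT i hi j hj, hρT j hj, Pi.one_apply]
  · intro j hj x z
    simp only [Set.indicator_apply, hAT j hj, Pi.one_apply]

end Product

/-! ### The circularly symmetric complex Gaussian law -/

section Gaussian

/-- With variance `1/2` the density is at most `1/√π`, hence at most `1`. -/
theorem gaussianReal_Icc_le (x r : ℝ) :
    gaussianReal 0 (1 / 2) (Set.Icc (x - r) (x + r)) ≤ ENNReal.ofReal (2 * r) := by
  rw [gaussianReal_apply _ (by norm_num)]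
  calc ∫⁻ y in Set.Icc (x - r) (x + r), gaussianPDF 0 (1 / 2) y
      ≤ ∫⁻ _ in Set.Icc (x - r) (x + r), 1 := by
        refine lintegral_mono fun y => ?_
        rw [gaussianPDF, ← ENNReal.ofReal_one]
        refine ENNReal.ofReal_le_ofReal ?_
        rw [gaussianPDFReal]
        refine mul_le_one₀ (inv_le_one_of_one_le₀ ?_) (Real.exp_nonneg _)
          (Real.exp_le_one_iff.2 ?_)
        · rw [Real.one_le_sqrt]
          have := Real.pi_gt_three
          push_cast
          linarith
        · exact div_nonpos_of_nonpos_of_nonneg (by nlinarith [sq_nonneg (y - 0)]) (by positivity)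
    _ = ENNReal.ofReal (2 * r) := by
        rw [setLIntegral_const, one_mul, Real.volume_Icc]
        congr 1; ring

/-- The interval stays inside `[-3, 3]`, where the density is at least its value at `3`. -/
theorem exists_mul_le_gaussianReal_Icc : ∃ κ : ℝ, 0 < κ ∧ ∀ x r : ℝ, 0 ≤ r → r ≤ 1 → |x| ≤ 2 →
    ENNReal.ofReal (κ * r) ≤ gaussianReal 0 (1 / 2) (Set.Icc (x - r) (x + r)) := by
  have hp : 0 < gaussianPDFReal 0 (1 / 2) 3 := gaussianPDFReal_pos _ _ _ (by norm_num)
  refine ⟨2 * gaussianPDFReal 0 (1 / 2) 3, by positivity, fun x r hr hr1 hx => ?_⟩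
  rw [gaussianReal_apply _ (by norm_num)]
  calc ENNReal.ofReal (2 * gaussianPDFReal 0 (1 / 2) 3 * r)
      = ∫⁻ _ in Set.Icc (x - r) (x + r), ENNReal.ofReal (gaussianPDFReal 0 (1 / 2) 3) := by
        rw [setLIntegral_const, Real.volume_Icc, ← ENNReal.ofReal_mul hp.le]
        congr 1; ring
    _ ≤ ∫⁻ y in Set.Icc (x - r) (x + r), gaussianPDF 0 (1 / 2) y := by
        refine setLIntegral_mono (measurable_gaussianPDF _ _) fun y hy => ?_
        rw [gaussianPDF]
        refine ENNReal.ofReal_le_ofReal ?_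
        rw [gaussianPDFReal, gaussianPDFReal]
        have hy3 : |y| ≤ 3 := by
          rw [abs_le] at hx ⊢
          constructor <;> linarith [hy.1, hy.2, hx.1, hx.2]
        have : y ^ 2 ≤ 3 ^ 2 := sq_le_sq' (by linarith [(abs_le.1 hy3).1]) (abs_le.1 hy3).2
        simp only [sub_zero]
        gcongr

theorem measurable_complex_mk : Measurable fun p : ℝ × ℝ => (⟨p.1, p.2⟩ : ℂ) :=
  Complex.measurableEquivRealProd.symm.measurable

instance isGaussian_stdComplexGaussian : IsGaussian stdComplexGaussian := by
  have : stdComplexGaussian =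
      ((gaussianReal 0 (1 / 2)).prod (gaussianReal 0 (1 / 2))).map
        Complex.equivRealProdCLM.symm := by
    rw [stdComplexGaussian]
    congr 1
  rw [this]
  infer_instance

theorem stdComplexGaussian_closedBall_le (c : ℂ) {r : ℝ} (hr : 0 ≤ r) :
    stdComplexGaussian (Metric.closedBall c r) ≤ ENNReal.ofReal (4 * r ^ 2) := by
  rw [stdComplexGaussian, Measure.map_apply measurable_complex_mk
    Metric.isClosed_closedBall.measurableSet]
  calc _ ≤ ((gaussianReal 0 (1 / 2)).prod (gaussianReal 0 (1 / 2)))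
        (Set.Icc (c.re - r) (c.re + r) ×ˢ Set.Icc (c.im - r) (c.im + r)) := by
        refine measure_mono fun p hp => ?_
        have hp' : ‖(⟨p.1, p.2⟩ : ℂ) - c‖ ≤ r := by simpa [dist_eq_norm] using hp
        have h1 := abs_le.1 ((Complex.abs_re_le_norm _).trans hp')
        have h2 := abs_le.1 ((Complex.abs_im_le_norm _).trans hp')
        simp only [Complex.sub_re, Complex.sub_im] at h1 h2
        exact ⟨⟨by linarith [h1.1], by linarith [h1.2]⟩, ⟨by linarith [h2.1], by linarith [h2.2]⟩⟩
    _ ≤ ENNReal.ofReal (2 * r) * ENNReal.ofReal (2 * r) := by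
        rw [Measure.prod_prod]
        exact mul_le_mul' (gaussianReal_Icc_le _ _) (gaussianReal_Icc_le _ _)
    _ = _ := by
        rw [← ENNReal.ofReal_mul (by positivity)]
        congr 1; ring

/-- The disc contains the square of half-side `r/2` about `c`, whose mass factors. Bounding `‖c‖`
makes the constant uniform in the centre. -/
theorem exists_mul_le_stdComplexGaussian_closedBall : ∃ κ : ℝ, 0 < κ ∧ ∀ (c : ℂ) (r : ℝ),
    0 ≤ r → r ≤ 1 → ‖c‖ ≤ 2 →
      ENNReal.ofReal (κ * r ^ 2) ≤ stdComplexGaussian (Metric.closedBall c r) := by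
  obtain ⟨κ, hκ, h⟩ := exists_mul_le_gaussianReal_Icc
  refine ⟨κ ^ 2 / 4, by positivity, fun c r hr hr1 hc => ?_⟩
  rw [stdComplexGaussian, Measure.map_apply measurable_complex_mk
    Metric.isClosed_closedBall.measurableSet]
  calc _ = ENNReal.ofReal (κ * (r / 2)) * ENNReal.ofReal (κ * (r / 2)) := by
        rw [← ENNReal.ofReal_mul (by positivity)]
        congr 1; ring
    _ ≤ ((gaussianReal 0 (1 / 2)).prod (gaussianReal 0 (1 / 2)))
        (Set.Icc (c.re - r / 2) (c.re + r / 2) ×ˢ Set.Icc (c.im - r / 2) (c.im + r / 2)) := by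
        rw [Measure.prod_prod]
        exact mul_le_mul' (h _ _ (by positivity) (by linarith)
          ((Complex.abs_re_le_norm _).trans hc)) (h _ _ (by positivity) (by linarith)
          ((Complex.abs_im_le_norm _).trans hc))
    _ ≤ _ := by
        refine measure_mono fun p hp => ?_
        obtain ⟨⟨h1, h2⟩, h3, h4⟩ := hp
        have hn := Complex.norm_le_abs_re_add_abs_im ((⟨p.1, p.2⟩ : ℂ) - c)
        simp only [Complex.sub_re, Complex.sub_im] at hn
        have h5 : |p.1 - c.re| ≤ r / 2 := abs_le.2 ⟨by linarith, by linarith⟩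
        have h6 : |p.2 - c.im| ≤ r / 2 := abs_le.2 ⟨by linarith, by linarith⟩
        simp only [Set.mem_preimage, Metric.mem_closedBall, dist_eq_norm]
        linarith

/-- Gaussian laws have moments of all orders. This controls the interference from user `v`, which
enters the outage bound to the power `M - 2`. -/
theorem lintegral_one_add_mul_sq_pow_lt_top (κ : ℝ) (hκ : 0 ≤ κ) (n : ℕ) :
    ∫⁻ z, ENNReal.ofReal ((1 + κ * ‖z‖ ^ 2) ^ n) ∂stdComplexGaussian < ∞ := by
  have h1 : Integrable (fun z : ℂ => ‖z‖ ^ (2 * n)) stdComplexGaussian :=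
    (IsGaussian.memLp_id stdComplexGaussian (2 * n : ℕ)
      (ENNReal.natCast_ne_top _)).integrable_norm_pow'
  have h2 : Integrable (fun z : ℂ => 2 ^ (n - 1) * (1 + κ ^ n * ‖z‖ ^ (2 * n)))
      stdComplexGaussian := ((integrable_const _).add (h1.const_mul _)).const_mul _
  refine lt_of_le_of_lt (lintegral_mono fun z => ?_) h2.lintegral_lt_top
  refine ENNReal.ofReal_le_ofReal ((add_pow_le zero_le_one (by positivity) n).trans (le_of_eq ?_))
  rw [one_pow, mul_pow, ← pow_mul]

end Gaussian

/-! ### The zero-forcing gain -/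

section ZeroForcing

variable {ι : Type*} [Fintype ι]

theorem zfGain_nonneg (y s : EuclideanSpace ℂ ι) : 0 ≤ zfGain y s := by
  refine Real.sSup_nonneg ?_
  rintro _ ⟨g, -, rfl⟩
  positivity

/-- A feasible `g` annihilates `s`, so subtracting a multiple of `s` from `y` does not change `g†
y`; then Cauchy–Schwarz applies. -/
theorem zfGain_le_norm_sub_smul_sq (y s : EuclideanSpace ℂ ι) (c : ℂ) :
    zfGain y s ≤ ‖y - c • s‖ ^ 2 := by
  refine Real.sSup_le ?_ (by positivity)
  rintro _ ⟨g, ⟨hg1, hg0⟩, rfl⟩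
  have h : inner ℂ g y = inner ℂ g (y - c • s) := by
    rw [inner_sub_right, inner_smul_right, hg0, mul_zero, sub_zero]
  have := norm_inner_le_norm (𝕜 := ℂ) g (y - c • s)
  rw [hg1, one_mul] at this
  simp only [h]
  gcongr

/-- Take `c • s` to be the orthogonal projection of `y` onto the line of `s`; the normalized
residual is then feasible and attains the squared distance. If the residual vanishes, nonnegativity
of the gain suffices. -/
theorem exists_norm_sub_smul_sq_le_zfGain (y s : EuclideanSpace ℂ ι) :
    ∃ c : ℂ, ‖y - c • s‖ ^ 2 ≤ zfGain y s := by
  have hmem := Submodule.starProjection_apply_mem (ℂ ∙ s) y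
  obtain ⟨c, hc⟩ := Submodule.mem_span_singleton.1 hmem
  refine ⟨c, ?_⟩
  have horth : ∀ w ∈ (ℂ ∙ s), inner ℂ (y - c • s) w = 0 := fun w hw => by
    rw [hc]; exact Submodule.starProjection_inner_eq_zero y w hw
  have hs : inner ℂ (y - c • s) s = 0 := horth s (Submodule.mem_span_singleton_self s)
  by_cases h0 : y - c • s = 0
  · rw [h0]
    simpa using zfGain_nonneg y s
  set u := y - c • s with hu
  have hn : (‖u‖ : ℂ) ≠ 0 := by simpa using h0
  have hy : inner ℂ u y = (‖u‖ : ℂ) ^ 2 := by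
    have : y = u + c • s := by rw [hu]; abel
    rw [this, inner_add_right, inner_smul_right, hs, mul_zero, add_zero,
      inner_self_eq_norm_sq_to_K]
    rfl
  have hbdd : BddAbove ((fun g => ‖inner ℂ g y‖ ^ 2) '' zfFeasible s) := by
    refine ⟨‖y‖ ^ 2, ?_⟩
    rintro _ ⟨g, ⟨hg1, -⟩, rfl⟩
    have := norm_inner_le_norm (𝕜 := ℂ) g y
    rw [hg1, one_mul] at this
    dsimp only
    gcongr
  refine le_csSup hbdd ⟨((‖u‖ : ℂ)⁻¹) • u, ⟨?_, ?_⟩, ?_⟩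
  · rw [norm_smul, norm_inv, Complex.norm_real, norm_norm, inv_mul_cancel₀ (by simpa using h0)]
  · rw [inner_smul_left, hs, mul_zero]
  · simp only
    rw [inner_smul_left, hy]
    simp only [map_inv₀, Complex.conj_ofReal]
    rw [sq (‖u‖ : ℂ), inv_mul_cancel_left₀ hn, Complex.norm_real, norm_norm]

end ZeroForcing

/-! ### The links of the network as a finite index type -/

section Links

variable {M : ℕ}

noncomputable instance : DecidableEq (Link M) := Classical.decEq _

instance : Finite (Link M) :=
  Finite.of_injective
    (fun l : Link M => match l with
      | .fromPrimary k => ((0 : Fin 3), k)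
      | .toPrimaryDest k => (1, k)
      | .toSecondaryDest k => (2, k))
    (by rintro (k | k | k) (l | l | l) <;> simp)

noncomputable instance : Fintype (Link M) := Fintype.ofFinite _

/-- For every user `k` other than `v` and `j`, the link from `k` to the primary destination if
`k ∈ Λ`, and the link from the primary source to `k` otherwise. -/
noncomputable def criticalLinks (Λ : Finset (Fin M)) (j v : Fin M) : Finset (Link M) :=
  (Finset.univ \ {v, j}).image fun k =>
    if k ∈ Λ then Link.toPrimaryDest k else Link.fromPrimary k

theorem card_criticalLinks (Λ : Finset (Fin M)) {j v : Fin M} (hj : j ≠ v) :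
    (criticalLinks Λ j v).card = M - 2 := by
  rw [criticalLinks, Finset.card_image_of_injective, Finset.card_sdiff_of_subset
    (Finset.subset_univ _), Finset.card_pair hj.symm, Finset.card_univ, Fintype.card_fin]
  intro k l hkl
  dsimp only at hkl
  split_ifs at hkl <;> simpa using hkl

theorem toPrimaryDest_mem_criticalLinks {Λ : Finset (Fin M)} {j v k : Fin M} :
    Link.toPrimaryDest k ∈ criticalLinks Λ j v ↔ k ∈ Λ ∧ k ≠ v ∧ k ≠ j := by
  simp only [criticalLinks, Finset.mem_image, Finset.mem_sdiff, Finset.mem_univ, true_and,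
    Finset.mem_insert, Finset.mem_singleton, not_or]
  constructor
  · rintro ⟨l, hl, h⟩
    split_ifs at h with h1
    obtain rfl : l = k := by simpa using h
    exact ⟨h1, hl⟩
  · rintro ⟨h1, h2⟩
    exact ⟨k, h2, by rw [if_pos h1]⟩

theorem fromPrimary_mem_criticalLinks {Λ : Finset (Fin M)} {j v k : Fin M} :
    Link.fromPrimary k ∈ criticalLinks Λ j v ↔ k ∉ Λ ∧ k ≠ v ∧ k ≠ j := by
  simp only [criticalLinks, Finset.mem_image, Finset.mem_sdiff, Finset.mem_univ, true_and,
    Finset.mem_insert, Finset.mem_singleton, not_or]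
  constructor
  · rintro ⟨l, hl, h⟩
    split_ifs at h with h1
    obtain rfl : l = k := by simpa using h
    exact ⟨h1, hl⟩
  · rintro ⟨h1, h2⟩
    exact ⟨k, h2, by rw [if_neg h1]⟩

theorem toSecondaryDest_notMem_criticalLinks {Λ : Finset (Fin M)} {j v k : Fin M} :
    Link.toSecondaryDest k ∉ criticalLinks Λ j v := by
  simp only [criticalLinks, Finset.mem_image, not_exists, not_and]
  rintro l - h
  split_ifs at h

/-- The value around which the coefficient of a critical link has to lie in an outage: with
`c = h_{j,pd} / h_{j,sd}`, it is `c h_{k,sd}` for the link from `k` to the primary destination. -/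
noncomputable def criticalCenter (j : Fin M) (l : Link M) (x : Link M → ℂ) : ℂ :=
  match l with
  | .toPrimaryDest k => x (.toPrimaryDest j) / x (.toSecondaryDest j) * x (.toSecondaryDest k)
  | _ => 0

theorem measurable_criticalCenter (j : Fin M) (l : Link M) : Measurable (criticalCenter j l) := by
  rcases l with k | k | k <;> unfold criticalCenter <;> fun_prop

/-- The centres involve only the link from `j` to the primary destination and links to the secondary
destination, none of which is critical. This makes the coordinatewise integration legitimate. -/
theorem criticalCenter_update {Λ : Finset (Fin M)} {j v : Fin M} (i : Link M) {l : Link M}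
    (hl : l ∈ criticalLinks Λ j v) (x : Link M → ℂ) (z : ℂ) :
    criticalCenter j i (Function.update x l z) = criticalCenter j i x := by
  have h1 : Link.toPrimaryDest j ≠ l := by
    rintro rfl
    exact (toPrimaryDest_mem_criticalLinks.1 hl).2.2 rfl
  have h2 : ∀ k, Link.toSecondaryDest k ≠ l := by
    rintro k rfl
    exact toSecondaryDest_notMem_criticalLinks hl
  rcases i with k | k | k <;> simp [criticalCenter, Function.update_of_ne, h1, h2]

end Links

/-! ### Outage events -/

section Outage

variable {M : ℕ}

/-- The signal-to-noise threshold at rate `s`, normalized by `γ`. -/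
noncomputable def gainThreshold (s γ : ℝ) : ℝ := (2 ^ s - 1) / γ

theorem gainThreshold_pos {s γ : ℝ} (hs : 0 < s) (hγ : 0 < γ) : 0 < gainThreshold s γ :=
  div_pos (sub_pos.2 (Real.one_lt_rpow one_lt_two hs)) hγ

theorem gainThreshold_le_gainThreshold {s s' γ : ℝ} (h : s ≤ s') (hγ : 0 < γ) :
    gainThreshold s γ ≤ gainThreshold s' γ := by
  have := Real.rpow_le_rpow_of_exponent_le one_le_two h
  unfold gainThreshold
  gcongr

theorem le_logb_one_add_mul_iff {s γ u : ℝ} (hγ : 0 < γ) (hu : 0 ≤ u) :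
    s ≤ Real.logb 2 (1 + u * γ) ↔ gainThreshold s γ ≤ u := by
  rw [Real.le_logb_iff_rpow_le one_lt_two (by positivity), gainThreshold, div_le_iff₀ hγ]
  constructor <;> intro h <;> linarith

theorem mem_decodingSet_iff {x : Link M → ℂ} {v k : Fin M} {N₀ ζ γ R : ℝ} (hN₀ : 0 < N₀)
    (hγ : 0 < γ) :
    k ∈ decodingSet x v N₀ ζ (γ * N₀) R ↔
      k ≠ v ∧ gainThreshold (R / ζ) γ ≤ ‖x (.fromPrimary k)‖ ^ 2 := by
  rw [decodingSet, Finset.mem_filter, ← le_logb_one_add_mul_iff hγ (by positivity),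
    mul_div_cancel_right₀ _ hN₀.ne', mul_comm γ]
  simp

theorem sinr_eq {x : Link M → ℂ} {v : Fin M} {Λ : Finset (Fin M)} {N₀ Ps γ : ℝ}
    (hN₀ : 0 < N₀) (hPs : 0 < Ps) :
    sinr x v Λ N₀ Ps (γ * N₀) =
      zfGain (WithLp.toLp 2 fun k : Λ => x (.toPrimaryDest k))
        (WithLp.toLp 2 fun k : Λ => x (.toSecondaryDest k)) /
        (1 + Ps / N₀ * ‖x (.toPrimaryDest v)‖ ^ 2) * γ := by
  have h : N₀ + Ps * ‖x (.toPrimaryDest v)‖ ^ 2 ≠ 0 := by positivity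
  have h' : 1 + Ps / N₀ * ‖x (.toPrimaryDest v)‖ ^ 2 ≠ 0 := by positivity
  rw [sinr]
  field_simp

theorem logb_one_add_sinr_lt_iff {x : Link M → ℂ} {v : Fin M} {Λ : Finset (Fin M)}
    {N₀ Ps γ s : ℝ} (hN₀ : 0 < N₀) (hPs : 0 < Ps) (hγ : 0 < γ) :
    Real.logb 2 (1 + sinr x v Λ N₀ Ps (γ * N₀)) < s ↔
      zfGain (WithLp.toLp 2 fun k : Λ => x (.toPrimaryDest k))
        (WithLp.toLp 2 fun k : Λ => x (.toSecondaryDest k)) <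
        gainThreshold s γ * (1 + Ps / N₀ * ‖x (.toPrimaryDest v)‖ ^ 2) := by
  rw [sinr_eq hN₀ hPs, ← not_le, le_logb_one_add_mul_iff hγ
    (div_nonneg (zfGain_nonneg _ _) (by positivity)), not_le, div_lt_iff₀ (by positivity)]

/-- An outage forces `M - 2` channel coefficients to be close to centres that are functions of
the other coefficients. -/
theorem exists_criticalLinks_of_isOutage {x : Link M → ℂ} {v : Fin M} {N₀ Ps ζ γ R t : ℝ}
    (hM : 3 ≤ M) (hN₀ : 0 < N₀) (hPs : 0 < Ps) (hγ : 0 < γ) (ht : 0 ≤ t)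
    (h1 : gainThreshold (R / ζ) γ ≤ t) (h2 : gainThreshold (R / (1 - ζ)) γ ≤ t)
    (h : IsOutage x v N₀ Ps ζ (γ * N₀) R) :
    ∃ (j : Fin M) (Λ : Finset (Fin M)), j ≠ v ∧ ∀ l ∈ criticalLinks Λ j v,
      x l ∈ Metric.closedBall (criticalCenter j l x)
        (2 * √(t * (1 + Ps / N₀ * ‖x (.toPrimaryDest v)‖ ^ 2))) := by
  set y := t * (1 + Ps / N₀ * ‖x (.toPrimaryDest v)‖ ^ 2) with hy
  set D := decodingSet x v N₀ ζ (γ * N₀) R with hD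
  -- The interference factor is at least `1`, so one radius serves both for failed source links and
  -- for the beamforming constraint.
  have hty : t ≤ y := le_mul_of_one_le_right ht (le_add_of_nonneg_right (by positivity))
  have hfail : ∀ k, k ∉ D → k ≠ v → ‖x (.fromPrimary k)‖ ≤ 2 * √y := by
    intro k hk hkv
    rw [hD, mem_decodingSet_iff hN₀ hγ, not_and, not_le] at hk
    have : ‖x (.fromPrimary k)‖ ≤ √y := Real.le_sqrt_of_sq_le (by linarith [hk hkv])
    linarith [Real.sqrt_nonneg y]
  rw [IsOutage, ← hD] at h
  rcases h with hcard | ⟨hcard, hlt⟩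
  · obtain ⟨j, hjv, hjD⟩ : ∃ j, j ≠ v ∧ ∀ k ∈ D, k = j := by
      rcases Finset.eq_empty_or_nonempty D with h0 | ⟨j, hj⟩
      · have : Nontrivial (Fin M) := Fin.nontrivial_iff_two_le.2 (by omega)
        obtain ⟨j, hj⟩ := exists_ne v
        exact ⟨j, hj, by simp [h0]⟩
      · exact ⟨j, ((mem_decodingSet_iff hN₀ hγ).1 hj).1,
          fun k hk => Finset.card_le_one.1 (by omega) k hk j hj⟩
    -- With `Λ = ∅` all critical links are source links.
    refine ⟨j, ∅, hjv, fun l hl => ?_⟩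
    rcases l with k | k | k
    · obtain ⟨-, hkv, hkj⟩ := fromPrimary_mem_criticalLinks.1 hl
      simpa [criticalCenter] using hfail k (fun hk => hkj (hjD k hk)) hkv
    · simpa using (toPrimaryDest_mem_criticalLinks.1 hl).1
    · exact absurd hl toSecondaryDest_notMem_criticalLinks
  · have hne : D.Nonempty := Finset.card_pos.1 (by omega)
    -- Maximality of `|h_{j,sd}|` keeps the ratio `h_{k,sd} / h_{j,sd}` in the unit disc, so
    -- eliminating `c` does not amplify errors.
    obtain ⟨j, hj, hmax⟩ := D.exists_max_image (fun k => ‖x (.toSecondaryDest k)‖) hne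
    refine ⟨j, D, ((mem_decodingSet_iff hN₀ hγ).1 hj).1, fun l hl => ?_⟩
    rcases l with k | k | k
    · obtain ⟨hk, hkv, -⟩ := fromPrimary_mem_criticalLinks.1 hl
      simpa [criticalCenter] using hfail k hk hkv
    · have hk := (toPrimaryDest_mem_criticalLinks.1 hl).1
      rw [logb_one_add_sinr_lt_iff hN₀ hPs hγ] at hlt
      obtain ⟨c, hc⟩ := exists_norm_sub_smul_sq_le_zfGain
        (WithLp.toLp 2 fun k : D => x (.toPrimaryDest k))
        (WithLp.toLp 2 fun k : D => x (.toSecondaryDest k))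
      have hsq : ∀ i ∈ D, ‖x (.toPrimaryDest i) - c * x (.toSecondaryDest i)‖ ≤ √y := by
        intro i hi
        refine Real.le_sqrt_of_sq_le ?_
        have h3 : ‖x (.toPrimaryDest i) - c * x (.toSecondaryDest i)‖ ^ 2 ≤
            ‖(WithLp.toLp 2 fun k : D => x (.toPrimaryDest k)) -
              c • (WithLp.toLp 2 fun k : D => x (.toSecondaryDest k))‖ ^ 2 := by
          rw [EuclideanSpace.norm_sq_eq]
          exact Finset.single_le_sum (f := fun k : D =>
            ‖((WithLp.toLp 2 fun k : D => x (.toPrimaryDest k)) -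
              c • (WithLp.toLp 2 fun k : D => x (.toSecondaryDest k))) k‖ ^ 2)
            (fun _ _ => by positivity) (Finset.mem_univ (⟨i, hi⟩ : D))
        have h4 : gainThreshold (R / (1 - ζ)) γ *
            (1 + Ps / N₀ * ‖x (.toPrimaryDest v)‖ ^ 2) ≤ y :=
          mul_le_mul_of_nonneg_right h2 (by positivity)
        linarith
      rw [Metric.mem_closedBall, dist_eq_norm, criticalCenter]
      set s := x (.toSecondaryDest j)
      have hkj := hmax k hk
      have hsk := hsq k hk
      by_cases hs : s = 0
      · have hk0 : x (.toSecondaryDest k) = 0 := by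
          rw [hs, norm_zero] at hkj
          exact norm_le_zero_iff.1 hkj
        rw [hk0, mul_zero] at hsk ⊢
        linarith [Real.sqrt_nonneg y]
      -- The multiplier `c` depends on all coefficients and must disappear. Replacing it by
      -- `h_{j,pd} / h_{j,sd}` costs the error at `j` times a ratio of norm at most `1`; the two
      -- errors account for the radius `2 * √y`.
      · have hsplit : x (.toPrimaryDest k) - x (.toPrimaryDest j) / s * x (.toSecondaryDest k) =
            (x (.toPrimaryDest k) - c * x (.toSecondaryDest k)) -
              x (.toSecondaryDest k) / s * (x (.toPrimaryDest j) - c * s) := by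
          field_simp
          ring
        have hratio : ‖x (.toSecondaryDest k) / s‖ ≤ 1 := by
          rw [norm_div]
          exact div_le_one_of_le₀ hkj (norm_nonneg _)
        rw [hsplit]
        refine (norm_sub_le _ _).trans ?_
        rw [norm_mul]
        have := mul_le_mul hratio (hsq j hj) (norm_nonneg _) zero_le_one
        linarith
    · exact absurd hl toSecondaryDest_notMem_criticalLinks

/-- There is an outage if all relays but one are in a deep fade. -/
theorem isOutage_of_forall_fromPrimary {x : Link M → ℂ} {v j : Fin M} {N₀ Ps ζ γ R : ℝ}
    (hN₀ : 0 < N₀) (hγ : 0 < γ)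
    (h : ∀ k, k ≠ v → k ≠ j → ‖x (.fromPrimary k)‖ ^ 2 < gainThreshold (R / ζ) γ) :
    IsOutage x v N₀ Ps ζ (γ * N₀) R := by
  left
  have : decodingSet x v N₀ ζ (γ * N₀) R ⊆ {j} := by
    intro k hk
    obtain ⟨hkv, hle⟩ := (mem_decodingSet_iff hN₀ hγ).1 hk
    by_contra hkj
    exact absurd hle (not_le.2 (h k hkv (by simpa using hkj)))
  have := Finset.card_le_card this
  rw [Finset.card_singleton] at this
  omega

/-- There is an outage if the vector `h_pd` is nearly parallel to `h_sd`. -/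
theorem isOutage_of_forall_toPrimaryDest {x : Link M → ℂ} {v : Fin M} {N₀ Ps ζ γ R b : ℝ}
    (hN₀ : 0 < N₀) (hPs : 0 < Ps) (hγ : 0 < γ) (c : ℂ) (hb : 0 ≤ b)
    (h : ∀ k, k ≠ v → ‖x (.toPrimaryDest k) - c * x (.toSecondaryDest k)‖ ^ 2 ≤ b)
    (hMb : M * b < gainThreshold (R / (1 - ζ)) γ) :
    IsOutage x v N₀ Ps ζ (γ * N₀) R := by
  refine (Nat.lt_or_ge _ 2).imp_right fun hcard => ⟨hcard, ?_⟩
  rw [logb_one_add_sinr_lt_iff hN₀ hPs hγ]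
  set D := decodingSet x v N₀ ζ (γ * N₀) R with hD
  calc _ ≤ ‖(WithLp.toLp 2 fun k : D => x (.toPrimaryDest k)) -
        c • (WithLp.toLp 2 fun k : D => x (.toSecondaryDest k))‖ ^ 2 :=
        zfGain_le_norm_sub_smul_sq _ _ c
    _ = ∑ k : D, ‖x (.toPrimaryDest k) - c * x (.toSecondaryDest k)‖ ^ 2 := by
        rw [EuclideanSpace.norm_sq_eq]
        rfl
    _ ≤ ∑ _k : D, b := Finset.sum_le_sum fun k _ =>
        h k ((mem_decodingSet_iff hN₀ hγ).1 k.2).1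
    _ ≤ M * b := by
        rw [Finset.sum_const, nsmul_eq_mul, Finset.card_univ, Fintype.card_coe]
        have : D.card ≤ M := (Finset.card_le_univ D).trans (by simp)
        gcongr
    _ < gainThreshold (R / (1 - ζ)) γ := hMb
    _ ≤ _ := by
        refine le_mul_of_one_le_right ?_ (le_add_of_nonneg_right (by positivity))
        have : (0 : ℝ) ≤ M * b := by positivity
        linarith

end Outage

/-! ### Bounds for the outage probability -/

section Probability

variable {M : ℕ} {Ω : Type*} [MeasurableSpace Ω] {μ : Measure Ω}

/-- The joint law of all channel coefficients. -/
noncomputable def channelLaw (M : ℕ) : Measure (Link M → ℂ) :=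
  Measure.pi fun _ => stdComplexGaussian

instance : IsProbabilityMeasure (channelLaw M) := by
  unfold channelLaw
  infer_instance

theorem IsRayleigh.map_eq [IsProbabilityMeasure μ] {h : Link M → Ω → ℂ} (hh : IsRayleigh μ h) :
    μ.map (fun ω l => h l ω) = channelLaw M := by
  rw [(iIndepFun_iff_map_fun_eq_pi_map fun l => (hh.measurable l).aemeasurable).1 hh.indep,
    channelLaw]
  simp only [hh.law]

theorem IsRayleigh.measure_preimage [IsProbabilityMeasure μ] {h : Link M → Ω → ℂ}
    (hh : IsRayleigh μ h) {E : Set (Link M → ℂ)} (hE : MeasurableSet E) :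
    μ {ω | (fun l => h l ω) ∈ E} = channelLaw M E := by
  rw [← hh.map_eq, Measure.map_apply (measurable_pi_lambda _ hh.measurable) hE]
  rfl

theorem measurableSet_forall_mem_closedBall (T : Finset (Link M)) (j : Fin M)
    {ρ : (Link M → ℂ) → ℝ} (hρ : Measurable ρ) :
    MeasurableSet {x : Link M → ℂ | ∀ l ∈ T,
      x l ∈ Metric.closedBall (criticalCenter j l x) (ρ x)} := by
  have : {x : Link M → ℂ | ∀ l ∈ T, x l ∈ Metric.closedBall (criticalCenter j l x) (ρ x)} =
      ⋂ l ∈ T, {x : Link M → ℂ | dist (x l) (criticalCenter j l x) ≤ ρ x} := by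
    ext x; simp
  rw [this]
  exact Finset.measurableSet_biInter _ fun l _ =>
    measurableSet_le ((measurable_pi_apply l).dist (measurable_criticalCenter j l)) hρ

/-- Union bound over the pairs `(j, Λ)`. The factor `16 = 4 * 2 ^ 2` per critical link comes from
the disc estimate at radius `2 * √y`. -/
theorem exists_outageProb_le [IsProbabilityMeasure μ] (hM : 3 ≤ M) {h : Link M → Ω → ℂ}
    (hh : IsRayleigh μ h) (v : Fin M) {N₀ Ps : ℝ} (ζ : ℝ) (hN₀ : 0 < N₀) (hPs : 0 < Ps) :
    ∃ C : ℝ, 0 < C ∧ ∀ (R : ℝ → ℝ) (γ t : ℝ), 0 < γ → 0 ≤ t →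
      gainThreshold (R γ / ζ) γ ≤ t → gainThreshold (R γ / (1 - ζ)) γ ≤ t →
        outageProb μ h v N₀ Ps ζ R γ ≤ C * t ^ (M - 2) := by
  set κ := Ps / N₀ with hκ
  have hκ0 : 0 ≤ κ := by positivity
  set K := ∫⁻ z, ENNReal.ofReal ((1 + κ * ‖z‖ ^ 2) ^ (M - 2)) ∂stdComplexGaussian with hK
  have hKtop : K ≠ ∞ := (lintegral_one_add_mul_sq_pow_lt_top κ hκ0 (M - 2)).ne
  set N := Fintype.card (Fin M × Finset (Fin M)) with hN
  -- The summand `1` only makes positivity of the constant immediate.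
  refine ⟨N * 16 ^ (M - 2) * (K.toReal + 1), ?_, fun R γ t hγ ht h1 h2 => ?_⟩
  · have : 0 < N := Fintype.card_pos_iff.2 ⟨(v, ∅)⟩
    positivity
  set ρ : (Link M → ℂ) → ℝ := fun x => 2 * √(t * (1 + κ * ‖x (.toPrimaryDest v)‖ ^ 2)) with hρ
  have hρm : Measurable ρ := by fun_prop
  set E : Fin M × Finset (Fin M) → Set (Link M → ℂ) := fun p =>
    {x | p.1 ≠ v ∧ ∀ l ∈ criticalLinks p.2 p.1 v,
      x l ∈ Metric.closedBall (criticalCenter p.1 l x) (ρ x)} with hE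
  have hEm : ∀ p, MeasurableSet (E p) := fun p =>
    (MeasurableSet.const _).inter (measurableSet_forall_mem_closedBall _ _ hρm)
  have hEle : ∀ p, channelLaw M (E p) ≤ ENNReal.ofReal ((16 * t) ^ (M - 2)) * K := by
    rintro ⟨j, Λ⟩
    by_cases hj : j = v
    · have : E (j, Λ) = ∅ := by
        ext x; simp [hE, hj]
      simp [this]
    have hset : E (j, Λ) = {x | x ∈ (Set.univ : Set (Link M → ℂ)) ∧ ∀ l ∈ criticalLinks Λ j v,
        x l ∈ Metric.closedBall (criticalCenter j l x) (ρ x)} := by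
      ext x; simp [hE, hj]
    rw [hset, channelLaw, pi_forall_mem_closedBall_eq _ _ MeasurableSet.univ (by simp)
      (measurable_criticalCenter j) (fun i _ l hl x z => criticalCenter_update i hl x z) hρm,
      Measure.restrict_univ]
    · calc _ ≤ ∫⁻ x : Link M → ℂ, ENNReal.ofReal ((16 * t) ^ (M - 2)) *
            ENNReal.ofReal ((1 + κ * ‖x (.toPrimaryDest v)‖ ^ 2) ^ (M - 2))
              ∂Measure.pi fun _ => stdComplexGaussian := by
            refine lintegral_mono fun x => ?_
            refine (Finset.prod_le_pow_card _ _ _ fun l _ =>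
              stdComplexGaussian_closedBall_le _ (by positivity)).trans (le_of_eq ?_)
            rw [card_criticalLinks Λ hj, ← ENNReal.ofReal_pow (by positivity),
              ← ENNReal.ofReal_mul (by positivity), ← mul_pow]
            congr 2
            simp only [hρ]
            rw [mul_pow, Real.sq_sqrt (by positivity)]
            ring
        _ = _ := by
            have hm : Measurable fun z : ℂ =>
                ENNReal.ofReal ((1 + κ * ‖z‖ ^ 2) ^ (M - 2)) := by fun_prop
            have hm' : Measurable fun x : Link M → ℂ =>
                ENNReal.ofReal ((1 + κ * ‖x (.toPrimaryDest v)‖ ^ 2) ^ (M - 2)) :=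
              hm.comp (measurable_pi_apply _)
            rw [lintegral_const_mul _ hm', hK]
            congr 1
            exact (measurePreserving_eval (fun _ : Link M => stdComplexGaussian)
              (.toPrimaryDest v)).lintegral_comp hm
    · intro l hl x z
      have : Link.toPrimaryDest v ≠ l := by
        rintro rfl
        exact (toPrimaryDest_mem_criticalLinks.1 hl).2.1 rfl
      simp [hρ, Function.update_of_ne this]
  have hsub : {ω | IsOutage (fun l => h l ω) v N₀ Ps ζ (γ * N₀) (R γ)} ⊆
      ⋃ p, {ω | (fun l => h l ω) ∈ E p} := by
    intro ω hω
    obtain ⟨j, Λ, hj, hl⟩ := exists_criticalLinks_of_isOutage hM hN₀ hPs hγ ht h1 h2 hω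
    exact Set.mem_iUnion.2 ⟨(j, Λ), hj, hl⟩
  have hmeas : μ {ω | IsOutage (fun l => h l ω) v N₀ Ps ζ (γ * N₀) (R γ)} ≤
      N * (ENNReal.ofReal ((16 * t) ^ (M - 2)) * K) := by
    -- Only monotonicity is applied to the outage event itself, so its measurability is never
    -- needed.
    refine (measure_mono hsub).trans ((measure_iUnion_fintype_le _ _).trans ?_)
    simp only [hh.measure_preimage (hEm _)]
    refine (Finset.sum_le_card_nsmul _ _ _ fun p _ => hEle p).trans (le_of_eq ?_)
    rw [nsmul_eq_mul, Finset.card_univ]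
  have htop : (N : ℝ≥0∞) * (ENNReal.ofReal ((16 * t) ^ (M - 2)) * K) ≠ ∞ :=
    ENNReal.mul_ne_top (ENNReal.natCast_ne_top _) (ENNReal.mul_ne_top ENNReal.ofReal_ne_top hKtop)
  have := ENNReal.toReal_mono htop hmeas
  rw [ENNReal.toReal_mul, ENNReal.toReal_mul, ENNReal.toReal_ofReal (by positivity),
    ENNReal.toReal_natCast] at this
  refine this.trans ?_
  have h3 : K.toReal ≤ K.toReal + 1 := by linarith
  calc (N : ℝ) * ((16 * t) ^ (M - 2) * K.toReal)
      ≤ N * ((16 * t) ^ (M - 2) * (K.toReal + 1)) := by gcongr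
    _ = _ := by rw [mul_pow]; ring

/-- A lower bound for the probability that the coefficients of the critical links lie in small
balls. -/
theorem exists_le_channelLaw_forall_mem_closedBall (M : ℕ) : ∃ κ : ℝ, 0 < κ ∧
    ∀ {Λ : Finset (Fin M)} {j v : Fin M} (_ : j ≠ v) {A : Set (Link M → ℂ)}
      (_ : MeasurableSet A)
      (_ : ∀ l ∈ criticalLinks Λ j v, ∀ x z, Function.update x l z ∈ A ↔ x ∈ A)
      (_ : ∀ x ∈ A, ∀ l ∈ criticalLinks Λ j v, ‖criticalCenter j l x‖ ≤ 2)
      (r : ℝ) (_ : 0 ≤ r) (_ : r ≤ 1),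
      ENNReal.ofReal ((κ * r ^ 2) ^ (M - 2)) * channelLaw M A ≤
        channelLaw M {x | x ∈ A ∧ ∀ l ∈ criticalLinks Λ j v,
          x l ∈ Metric.closedBall (criticalCenter j l x) r} := by
  obtain ⟨κ, hκ, hball⟩ := exists_mul_le_stdComplexGaussian_closedBall
  refine ⟨κ, hκ, fun {Λ j v} hj {A} hA hAT hc r hr hr1 => ?_⟩
  rw [channelLaw, pi_forall_mem_closedBall_eq _ _ hA hAT (measurable_criticalCenter j)
    (fun i _ l hl x z => criticalCenter_update i hl x z) (ρ := fun _ => r) measurable_const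
    (fun _ _ _ _ => rfl), ← setLIntegral_const]
  refine setLIntegral_mono_ae' hA (Eventually.of_forall fun x hx => ?_)
  rw [ENNReal.ofReal_pow (by positivity), ← card_criticalLinks Λ hj]
  exact Finset.pow_card_le_prod _ _ _ fun l hl => hball _ _ hr hr1 (hc x hx l hl)

theorem le_outageProb_of_subset [IsProbabilityMeasure μ] {h : Link M → Ω → ℂ}
    (hh : IsRayleigh μ h) (v : Fin M) {N₀ Ps ζ γ c : ℝ} {R : ℝ → ℝ} {E : Set (Link M → ℂ)}
    (hE : MeasurableSet E)
    (hsub : ∀ x ∈ E, IsOutage x v N₀ Ps ζ (γ * N₀) (R γ))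
    (hc : ENNReal.ofReal c ≤ channelLaw M E) :
    c ≤ outageProb μ h v N₀ Ps ζ R γ := by
  rw [← hh.measure_preimage hE] at hc
  have h1 : μ {ω | (fun l => h l ω) ∈ E} ≤
      μ {ω | IsOutage (fun l => h l ω) v N₀ Ps ζ (γ * N₀) (R γ)} :=
    measure_mono fun ω hω => hsub _ hω
  exact (ENNReal.ofReal_le_iff_le_toReal (measure_ne_top _ _)).1 (hc.trans h1)

/-- Fix one relay `j` and let the other `M - 2` source links fade. Truncating the threshold at `1`
keeps the radius in the range of the small-ball estimate. -/
theorem exists_le_outageProb_of_fromPrimary [IsProbabilityMeasure μ] (hM : 3 ≤ M)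
    {h : Link M → Ω → ℂ} (hh : IsRayleigh μ h) (v : Fin M) {N₀ : ℝ} (Ps : ℝ) {ζ : ℝ}
    (hN₀ : 0 < N₀) (hζ : 0 < ζ) :
    ∃ c : ℝ, 0 < c ∧ ∀ (R : ℝ → ℝ) (γ : ℝ), 0 < γ → 0 < R γ →
      c * (min (gainThreshold (R γ / ζ) γ) 1) ^ (M - 2) ≤ outageProb μ h v N₀ Ps ζ R γ := by
  obtain ⟨κ, hκ, hlow⟩ := exists_le_channelLaw_forall_mem_closedBall M
  have : Nontrivial (Fin M) := Fin.nontrivial_iff_two_le.2 (by omega)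
  obtain ⟨j, hj⟩ := exists_ne v
  refine ⟨(κ / 4) ^ (M - 2), by positivity, fun R γ hγ hR => ?_⟩
  set m := min (gainThreshold (R γ / ζ) γ) 1 with hm
  have hm0 : 0 < m := lt_min (gainThreshold_pos (by positivity) hγ) one_pos
  -- Halving `√m` makes the fading condition strict.
  have hr1 : √m / 2 ≤ 1 := by
    have : √m ≤ 1 := Real.sqrt_le_one.2 (min_le_right _ _)
    linarith
  have hr2 : (√m / 2) ^ 2 = m / 4 := by
    rw [div_pow, Real.sq_sqrt hm0.le]; norm_num
  have hcen : ∀ x, ∀ l ∈ criticalLinks ∅ j v, criticalCenter j l x = 0 := by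
    rintro x (k | k | k) hl
    · rfl
    · simpa using (toPrimaryDest_mem_criticalLinks.1 hl).1
    · rfl
  have := hlow hj (Λ := ∅) MeasurableSet.univ (by simp) (fun x _ l hl => by
    rw [hcen x l hl]; simp) (√m / 2) (by positivity) hr1
  refine le_outageProb_of_subset hh v (MeasurableSet.univ.inter
    (measurableSet_forall_mem_closedBall (criticalLinks ∅ j v) j
      (ρ := fun _ => √m / 2) measurable_const)) ?_ (le_trans (le_of_eq ?_) this)
  · rintro x ⟨-, hx⟩
    refine isOutage_of_forall_fromPrimary (j := j) hN₀ hγ fun k hkv hkj => ?_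
    have hmem := fromPrimary_mem_criticalLinks.2 ⟨Finset.notMem_empty k, hkv, hkj⟩
    have h1 : ‖x (.fromPrimary k)‖ ≤ √m / 2 := by
      simpa [hcen x _ hmem] using hx _ hmem
    calc ‖x (.fromPrimary k)‖ ^ 2 ≤ (√m / 2) ^ 2 := by gcongr
      _ = m / 4 := hr2
      _ < m := by linarith
      _ ≤ _ := min_le_left _ _
  · rw [measure_univ, mul_one, hr2, ← mul_pow]
    congr 2; ring

/-- The non-critical coefficients are confined to a box `A` of positive probability on which
`|h_{j,sd}| ≥ 1` and the others are at most `1/2`. The centres then stay bounded, and conditionally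
on `A` each of the `M - 2` critical links hits its ball with probability of order at least `m`. -/
theorem exists_le_outageProb_of_toPrimaryDest [IsProbabilityMeasure μ] (hM : 3 ≤ M)
    {h : Link M → Ω → ℂ} (hh : IsRayleigh μ h) (v : Fin M) {N₀ Ps ζ : ℝ}
    (hN₀ : 0 < N₀) (hPs : 0 < Ps) (hζ : ζ < 1) :
    ∃ c : ℝ, 0 < c ∧ ∀ (R : ℝ → ℝ) (γ : ℝ), 0 < γ → 0 < R γ →
      c * (min (gainThreshold (R γ / (1 - ζ)) γ) 1) ^ (M - 2) ≤
        outageProb μ h v N₀ Ps ζ R γ := by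
  obtain ⟨κ, hκ, hlow⟩ := exists_le_channelLaw_forall_mem_closedBall M
  obtain ⟨κ', hκ', hball⟩ := exists_mul_le_stdComplexGaussian_closedBall
  have : Nontrivial (Fin M) := Fin.nontrivial_iff_two_le.2 (by omega)
  obtain ⟨j, hj⟩ := exists_ne v
  -- Taking all users for `Λ` makes the near-parallelism hold for any decoding set, so the source
  -- links need no control.
  set T := criticalLinks Finset.univ j v with hT
  set c₀ : Link M → ℂ := fun l => if l = .toSecondaryDest j then 3 / 2 else 0 with hc₀
  set A : Set (Link M → ℂ) := Set.univ.pi fun l =>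
    if l ∈ T then Set.univ else Metric.closedBall (c₀ l) (1 / 2) with hA
  have hAm : MeasurableSet A := MeasurableSet.univ_pi fun l => by
    split_ifs
    · exact MeasurableSet.univ
    · exact Metric.isClosed_closedBall.measurableSet
  have hApos : 0 < channelLaw M A := by
    rw [hA, channelLaw, Measure.pi_pi]
    refine CanonicallyOrderedAdd.prod_pos.2 fun l _ => ?_
    split_ifs
    · simp
    · refine lt_of_lt_of_le ?_ (hball (c₀ l) (1 / 2) (by norm_num) (by norm_num) ?_)
      · rw [ENNReal.ofReal_pos]; positivity
      · simp only [hc₀]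
        split_ifs <;> norm_num
  have hAball : ∀ x ∈ A, ∀ l ∉ T, ‖x l - c₀ l‖ ≤ 1 / 2 := by
    intro x hx l hl
    have := hx l (Set.mem_univ l)
    dsimp only at this
    rwa [if_neg hl, Metric.mem_closedBall, dist_eq_norm] at this
  have hAT : ∀ l ∈ T, ∀ x z, Function.update x l z ∈ A ↔ x ∈ A := by
    intro l hl x z
    simp only [hA, Set.mem_univ_pi]
    refine forall_congr' fun i => ?_
    by_cases hi : i = l
    · subst hi
      simp [hl]
    · rw [Function.update_of_ne hi]
  have hnum : ∀ x ∈ A, ‖x (.toPrimaryDest j)‖ ≤ 1 / 2 := by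
    intro x hx
    have := hAball x hx (.toPrimaryDest j)
      (fun hmem => (toPrimaryDest_mem_criticalLinks.1 hmem).2.2 rfl)
    simpa [hc₀] using this
  have hden : ∀ x ∈ A, 1 ≤ ‖x (.toSecondaryDest j)‖ := by
    intro x hx
    have h1 := hAball x hx (.toSecondaryDest j) toSecondaryDest_notMem_criticalLinks
    have h2 := norm_sub_norm_le (c₀ (.toSecondaryDest j)) (x (.toSecondaryDest j))
    rw [norm_sub_rev] at h2
    have h3 : ‖c₀ (.toSecondaryDest j)‖ = 3 / 2 := by simp [hc₀]
    linarith
  have hcen : ∀ x ∈ A, ∀ l ∈ T, ‖criticalCenter j l x‖ ≤ 2 := by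
    rintro x hx (k | k | k) hl
    · simp [criticalCenter]
    · have hkj := (toPrimaryDest_mem_criticalLinks.1 hl).2.2
      have h1 : ‖x (.toSecondaryDest k)‖ ≤ 1 / 2 := by
        simpa [hc₀, hkj] using hAball x hx (.toSecondaryDest k)
          toSecondaryDest_notMem_criticalLinks
      have h2 : ‖x (.toPrimaryDest j) / x (.toSecondaryDest j)‖ ≤ 1 := by
        rw [norm_div]
        exact div_le_one_of_le₀ (by linarith [hnum x hx, hden x hx]) (norm_nonneg _)
      rw [criticalCenter, norm_mul]
      have := mul_le_mul h2 h1 (norm_nonneg _) zero_le_one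
      linarith
    · simp [criticalCenter]
  set p := (channelLaw M A).toReal with hp
  have hp0 : 0 < p := ENNReal.toReal_pos hApos.ne' (measure_ne_top _ _)
  have hM0 : (0 : ℝ) < M := by exact_mod_cast (by omega : 0 < M)
  have hM1 : (1 : ℝ) ≤ M := by exact_mod_cast (by omega : 1 ≤ M)
  refine ⟨(κ / (2 * M)) ^ (M - 2) * p, by positivity, fun R γ hγ hR => ?_⟩
  set m := min (gainThreshold (R γ / (1 - ζ)) γ) 1 with hm
  have hm0 : 0 < m := lt_min (gainThreshold_pos (div_pos hR (by linarith)) hγ) one_pos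
  have hr2 : √(m / (2 * M)) ^ 2 = m / (2 * M) := Real.sq_sqrt (by positivity)
  have hr1 : √(m / (2 * M)) ≤ 1 := by
    refine Real.sqrt_le_one.2 (div_le_one_of_le₀ ?_ (by positivity))
    have : m ≤ 1 := min_le_right _ _
    linarith
  have := hlow hj hAm hAT hcen (√(m / (2 * M))) (by positivity) hr1
  refine le_outageProb_of_subset hh v (hAm.inter (measurableSet_forall_mem_closedBall T j
    (ρ := fun _ => √(m / (2 * M))) measurable_const)) ?_ (le_trans (le_of_eq ?_) this)
  · rintro x ⟨hxA, hx⟩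
    -- With this multiplier the residual at `j` is exactly zero, and `M * b = m / 2` lies strictly
    -- below the threshold.
    refine isOutage_of_forall_toPrimaryDest (b := m / (2 * M)) hN₀ hPs hγ
      (x (.toPrimaryDest j) / x (.toSecondaryDest j)) (by positivity) (fun k hkv => ?_) ?_
    · by_cases hkj : k = j
      · have : x (.toSecondaryDest j) ≠ 0 := by
          rw [← norm_pos_iff]; linarith [hden x hxA]
        rw [hkj, div_mul_cancel₀ _ this, sub_self, norm_zero, zero_pow two_ne_zero]
        positivity
      · have h1 := hx _ (toPrimaryDest_mem_criticalLinks.2 ⟨Finset.mem_univ k, hkv, hkj⟩)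
        rw [Metric.mem_closedBall, dist_eq_norm] at h1
        rw [← hr2]
        exact pow_le_pow_left₀ (norm_nonneg _) h1 2
    · calc (M : ℝ) * (m / (2 * M)) = m / 2 := by field_simp
        _ < m := by linarith
        _ ≤ _ := min_le_left _ _
  · rw [hr2, ← ENNReal.ofReal_toReal (measure_ne_top (channelLaw M) A), ← hp,
      ← ENNReal.ofReal_mul (by positivity)]
    congr 1
    rw [mul_right_comm, ← mul_pow]
    congr 2; ring

/-- Up to constants, the outage probability is the power `M - 2` of the larger one of the two
normalized thresholds, as long as that threshold is at most `1`. -/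
theorem exists_outageProb_bounds [IsProbabilityMeasure μ] (hM : 3 ≤ M) {h : Link M → Ω → ℂ}
    (hh : IsRayleigh μ h) (v : Fin M) {N₀ Ps ζ : ℝ} (hN₀ : 0 < N₀) (hPs : 0 < Ps)
    (hζ₀ : 0 < ζ) (hζ₁ : ζ < 1) :
    ∃ c C : ℝ, 0 < c ∧ 0 < C ∧ ∀ (R : ℝ → ℝ) (γ : ℝ), 0 < γ → 0 < R γ →
      c * (min (gainThreshold (max (1 / ζ) (1 / (1 - ζ)) * R γ) γ) 1) ^ (M - 2) ≤
          outageProb μ h v N₀ Ps ζ R γ ∧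
        outageProb μ h v N₀ Ps ζ R γ ≤
          C * gainThreshold (max (1 / ζ) (1 / (1 - ζ)) * R γ) γ ^ (M - 2) := by
  obtain ⟨C, hC, hup⟩ := exists_outageProb_le hM hh v ζ hN₀ hPs
  obtain ⟨c₁, hc₁, hlow₁⟩ := exists_le_outageProb_of_fromPrimary hM hh v Ps hN₀ hζ₀
  obtain ⟨c₂, hc₂, hlow₂⟩ := exists_le_outageProb_of_toPrimaryDest hM hh v hN₀ hPs hζ₁
  have hζ' : 0 < 1 - ζ := by linarith
  refine ⟨min c₁ c₂, C, lt_min hc₁ hc₂, hC, fun R γ hγ hR => ⟨?_, ?_⟩⟩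
  · have hpos : ∀ {s : ℝ}, 0 < s → 0 ≤ min (gainThreshold (s * R γ) γ) 1 := fun hs =>
      le_min (gainThreshold_pos (mul_pos hs hR) hγ).le zero_le_one
    -- The hop that attains the maximum is the bottleneck and supplies the lower bound.
    rcases max_choice (1 / ζ) (1 / (1 - ζ)) with hq | hq
    · rw [hq]
      have := hpos (one_div_pos.2 hζ₀)
      refine le_trans (mul_le_mul_of_nonneg_right (min_le_left c₁ c₂) (by positivity)) ?_
      rw [one_div_mul_eq_div]
      exact hlow₁ R γ hγ hR
    · rw [hq]
      have := hpos (one_div_pos.2 hζ')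
      refine le_trans (mul_le_mul_of_nonneg_right (min_le_right c₁ c₂) (by positivity)) ?_
      rw [one_div_mul_eq_div]
      exact hlow₂ R γ hγ hR
  · have hq : 0 < max (1 / ζ) (1 / (1 - ζ)) := lt_max_of_lt_left (by positivity)
    refine hup R γ _ hγ (gainThreshold_pos (mul_pos hq hR) hγ).le ?_ ?_
    · rw [← one_div_mul_eq_div]
      exact gainThreshold_le_gainThreshold (by gcongr; exact le_max_left _ _) hγ
    · rw [← one_div_mul_eq_div]
      exact gainThreshold_le_gainThreshold (by gcongr; exact le_max_right _ _) hγ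

end Probability

/-! ### Asymptotics in the signal-to-noise ratio -/

section Asymptotics

theorem HasMultiplexingGain.nonneg {R : ℝ → ℝ} {r : ℝ} (hR : IsDataRate R)
    (hr : HasMultiplexingGain R r) : 0 ≤ r := by
  obtain ⟨c, hc, hcR⟩ := hR
  refine ge_of_tendsto hr ?_
  filter_upwards [hcR, eventually_gt_atTop 1] with γ h1 h2
  exact div_nonneg (by linarith) (Real.logb_nonneg one_lt_two h2.le)

/-- Since `R ≥ c` eventually, `2^(qR) - 1` lies between `(1 - 2^(-qc)) 2^(qR)` and `2^(qR)`, so its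
logarithm is `qR log 2` up to a bounded error, negligible against `log γ`. Without a positive lower
bound on the rate the subtracted `1` could dominate. -/
theorem tendsto_log_gainThreshold_div_log {R : ℝ → ℝ} {r q : ℝ} (hR : IsDataRate R)
    (hr : HasMultiplexingGain R r) (hq : 0 < q) :
    Tendsto (fun γ => Real.log (gainThreshold (q * R γ) γ) / Real.log γ) atTop
      (𝓝 (q * r - 1)) := by
  obtain ⟨c, hc, hcR⟩ := hR
  have hqc : 0 < q * c := by positivity
  have hlt : (2 : ℝ) ^ (-(q * c)) < 1 := Real.rpow_lt_one_of_one_lt_of_neg one_lt_two (by linarith)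
  set K := Real.log (1 - 2 ^ (-(q * c))) with hK
  have hlim : Tendsto (fun γ => q * (R γ / Real.logb 2 γ) - 1) atTop (𝓝 (q * r - 1)) :=
    (hr.const_mul q).sub_const 1
  have hlow : Tendsto (fun γ => K / Real.log γ + (q * (R γ / Real.logb 2 γ) - 1)) atTop
      (𝓝 (q * r - 1)) := by
    simpa using (Real.tendsto_log_atTop.const_div_atTop K).add hlim
  have hmain : ∀ᶠ γ : ℝ in atTop,
      K / Real.log γ + (q * (R γ / Real.logb 2 γ) - 1) ≤
          Real.log (gainThreshold (q * R γ) γ) / Real.log γ ∧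
        Real.log (gainThreshold (q * R γ) γ) / Real.log γ ≤ q * (R γ / Real.logb 2 γ) - 1 := by
    filter_upwards [hcR, eventually_gt_atTop 1] with γ h1 h2
    have hγ : 0 < γ := by linarith
    have hlog : 0 < Real.log γ := Real.log_pos h2
    have hs : q * c ≤ q * R γ := by gcongr
    have hs1 : (1 : ℝ) < 2 ^ (q * R γ) := Real.one_lt_rpow one_lt_two (by linarith)
    have hpow : Real.log (2 ^ (q * R γ)) = q * R γ * Real.log 2 := Real.log_rpow two_pos _
    have hexp : Real.log (gainThreshold (q * R γ) γ) =
        Real.log (2 ^ (q * R γ) - 1) - Real.log γ := by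
      rw [gainThreshold, Real.log_div (by linarith) hγ.ne']
    have heq : q * (R γ / Real.logb 2 γ) - 1 =
        (q * R γ * Real.log 2 - Real.log γ) / Real.log γ := by
      have := Real.log_pos one_lt_two
      rw [Real.logb]
      field_simp
    have hle : Real.log (2 ^ (q * R γ) - 1) ≤ q * R γ * Real.log 2 := by
      rw [← hpow]
      exact Real.log_le_log (by linarith) (by linarith)
    have hge : K + q * R γ * Real.log 2 ≤ Real.log (2 ^ (q * R γ) - 1) := by
      rw [← hpow, hK, ← Real.log_mul (by linarith) (by positivity)]
      refine Real.log_le_log (mul_pos (by linarith) (by positivity)) ?_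
      have : (1 : ℝ) ≤ 2 ^ (-(q * c)) * 2 ^ (q * R γ) := by
        rw [← Real.rpow_add two_pos]
        exact Real.one_le_rpow one_le_two (by linarith)
      linarith
    rw [hexp, heq, ← add_div]
    exact ⟨by gcongr; linarith, by gcongr⟩
  exact tendsto_of_tendsto_of_tendsto_of_le_of_le' hlow hlim
    (hmain.mono fun _ h => h.1) (hmain.mono fun _ h => h.2)

theorem tendsto_log_const_mul_pow_div_log {f : ℝ → ℝ} {L c : ℝ} (n : ℕ) (hc : 0 < c)
    (hf : ∀ᶠ γ in atTop, 0 < f γ)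
    (h : Tendsto (fun γ => Real.log (f γ) / Real.log γ) atTop (𝓝 L)) :
    Tendsto (fun γ => Real.log (c * f γ ^ n) / Real.log γ) atTop (𝓝 (n * L)) := by
  have h1 := (Real.tendsto_log_atTop.const_div_atTop (Real.log c)).add (h.const_mul (n : ℝ))
  rw [zero_add] at h1
  refine h1.congr' ?_
  filter_upwards [hf] with γ hγ
  rw [Real.log_mul hc.ne' (by positivity), Real.log_pow]
  ring

theorem tendsto_log_min_one_div_log {f : ℝ → ℝ} {L : ℝ} (hf : ∀ᶠ γ in atTop, 0 < f γ)
    (h : Tendsto (fun γ => Real.log (f γ) / Real.log γ) atTop (𝓝 L)) :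
    Tendsto (fun γ => Real.log (min (f γ) 1) / Real.log γ) atTop (𝓝 (min L 0)) := by
  refine (h.min tendsto_const_nhds).congr' ?_
  filter_upwards [hf, eventually_gt_atTop 1] with γ hγ h1
  have hlog := Real.log_pos h1
  rcases le_total (f γ) 1 with h2 | h2
  · rw [min_eq_left h2, min_eq_left (div_nonpos_of_nonpos_of_nonneg
      (Real.log_nonpos hγ.le h2) hlog.le)]
  · rw [min_eq_right h2, min_eq_right (div_nonneg (Real.log_nonneg h2) hlog.le), Real.log_one,
      zero_div]

/-- The diversity gain of a quantity that is bounded by the `n`-th power of the threshold. -/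
theorem hasDiversityGain_of_bounds {ν R : ℝ → ℝ} {r q c C : ℝ} {n : ℕ} (hR : IsDataRate R)
    (hr : HasMultiplexingGain R r) (hq : 0 < q) (hqr : q * r ≤ 1) (hc : 0 < c) (hC : 0 < C)
    (hν : ∀ γ, 0 < γ → 0 < R γ → c * (min (gainThreshold (q * R γ) γ) 1) ^ n ≤ ν γ ∧
      ν γ ≤ C * gainThreshold (q * R γ) γ ^ n) :
    HasDiversityGain ν ((1 - q * r) * n) := by
  have hRpos : ∀ᶠ γ in atTop, 0 < γ ∧ 0 < R γ := by
    obtain ⟨b, hb, hbR⟩ := hR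
    filter_upwards [hbR, eventually_gt_atTop 0] with γ h1 h2
    exact ⟨h2, by linarith⟩
  have hpos : ∀ᶠ γ in atTop, 0 < gainThreshold (q * R γ) γ :=
    hRpos.mono fun γ h => gainThreshold_pos (mul_pos hq h.2) h.1
  have hmin : ∀ᶠ γ in atTop, 0 < min (gainThreshold (q * R γ) γ) 1 :=
    hpos.mono fun γ h => lt_min h one_pos
  have hνpos : ∀ᶠ γ in atTop, 0 < ν γ := by
    filter_upwards [hRpos, hmin] with γ h1 h2
    exact lt_of_lt_of_le (by positivity) (hν γ h1.1 h1.2).1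
  have hlim := tendsto_log_gainThreshold_div_log hR hr hq
  have hup := tendsto_log_const_mul_pow_div_log n hC hpos hlim
  have hlow := tendsto_log_const_mul_pow_div_log n hc hmin (tendsto_log_min_one_div_log hpos hlim)
  -- For `q * r ≤ 1` truncating the threshold at `1` does not affect the exponent, even in the
  -- boundary case, where the exponent is `0`.
  rw [min_eq_left (by linarith)] at hlow
  refine ⟨hνpos, ?_⟩
  rw [show -((1 - q * r) * n) = n * (q * r - 1) by ring]
  refine tendsto_of_tendsto_of_tendsto_of_le_of_le' hlow hup ?_ ?_
  · filter_upwards [hRpos, hmin, eventually_gt_atTop 1] with γ h1 h2 h3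
    have := Real.log_pos h3
    have := Real.log_le_log (by positivity) (hν γ h1.1 h1.2).1
    gcongr
  · filter_upwards [hRpos, hνpos, eventually_gt_atTop 1] with γ h1 h2 h3
    have := Real.log_pos h3
    have := Real.log_le_log h2 (hν γ h1.1 h1.2).2
    gcongr

/-- This needs no relation between `q * r` and `1`: beyond `q * r = 1` the truncated threshold has
exponent `0`, which rules out positive diversity. -/
theorem HasDiversityGain.le_of_bound {ν R : ℝ → ℝ} {r d q c : ℝ} {n : ℕ}
    (hd : HasDiversityGain ν d) (hR : IsDataRate R) (hr : HasMultiplexingGain R r) (hq : 0 < q)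
    (hc : 0 < c)
    (hν : ∀ γ, 0 < γ → 0 < R γ → c * (min (gainThreshold (q * R γ) γ) 1) ^ n ≤ ν γ) :
    d ≤ n * max (1 - q * r) 0 := by
  have hRpos : ∀ᶠ γ in atTop, 0 < γ ∧ 0 < R γ := by
    obtain ⟨b, hb, hbR⟩ := hR
    filter_upwards [hbR, eventually_gt_atTop 0] with γ h1 h2
    exact ⟨h2, by linarith⟩
  have hpos : ∀ᶠ γ in atTop, 0 < gainThreshold (q * R γ) γ :=
    hRpos.mono fun γ h => gainThreshold_pos (mul_pos hq h.2) h.1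
  have hmin : ∀ᶠ γ in atTop, 0 < min (gainThreshold (q * R γ) γ) 1 :=
    hpos.mono fun γ h => lt_min h one_pos
  have hlow := tendsto_log_const_mul_pow_div_log n hc hmin
    (tendsto_log_min_one_div_log hpos (tendsto_log_gainThreshold_div_log hR hr hq))
  have hle : (n : ℝ) * min (q * r - 1) 0 ≤ -d := by
    refine le_of_tendsto_of_tendsto hlow hd.2 ?_
    filter_upwards [hRpos, hmin, eventually_gt_atTop 1] with γ h1 h2 h3
    have := Real.log_pos h3
    have := Real.log_le_log (by positivity) (hν γ h1.1 h1.2)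
    gcongr
  have hmm : max (1 - q * r) 0 = -min (q * r - 1) 0 := by
    rw [← max_neg_neg, neg_sub, neg_zero]
  rw [hmm]
  linarith

theorem isTheta_of_bounds {ν : ℝ → ℝ} {s c C : ℝ} {n : ℕ} (hs : 0 < s) (hc : 0 < c)
    (hν : ∀ γ, 0 < γ → c * (min (gainThreshold s γ) 1) ^ n ≤ ν γ ∧
      ν γ ≤ C * gainThreshold s γ ^ n) :
    ν =Θ[atTop] fun γ : ℝ => γ ^ (-(n : ℝ)) := by
  set a : ℝ := 2 ^ s - 1 with ha
  have ha0 : 0 < a := sub_pos.2 (Real.one_lt_rpow one_lt_two hs)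
  have hpow : ∀ γ : ℝ, 0 < γ → gainThreshold s γ ^ n = a ^ n * γ ^ (-(n : ℝ)) := by
    intro γ hγ
    rw [gainThreshold, ← ha, div_pow, Real.rpow_neg hγ.le, Real.rpow_natCast, div_eq_mul_inv]
  constructor
  · refine Asymptotics.IsBigO.of_bound (C * a ^ n) ?_
    filter_upwards [eventually_gt_atTop 0] with γ hγ
    have h1 := hν γ hγ
    have h2 := gainThreshold_pos hs hγ
    have h3 : 0 ≤ ν γ := le_trans (by positivity) h1.1
    rw [Real.norm_of_nonneg h3, Real.norm_of_nonneg (by positivity), mul_assoc, ← hpow γ hγ]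
    exact h1.2
  · refine Asymptotics.IsBigO.of_bound ((c * a ^ n)⁻¹) ?_
    -- From `γ ≥ a` on, the threshold is at most `1` and the truncation is inactive.
    filter_upwards [eventually_gt_atTop 0, eventually_ge_atTop a] with γ hγ hγa
    have h1 := hν γ hγ
    have h2 := gainThreshold_pos hs hγ
    have h3 : 0 ≤ ν γ := le_trans (by positivity) h1.1
    have h4 : gainThreshold s γ ≤ 1 := div_le_one_of_le₀ hγa hγ.le
    rw [min_eq_left h4, hpow γ hγ, ← mul_assoc] at h1
    rw [Real.norm_of_nonneg h3, Real.norm_of_nonneg (by positivity), ← div_eq_inv_mul,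
      le_div_iff₀ (by positivity), mul_comm]
    exact h1.1

/-- These are the witness rates for both maxima; the summand `1` keeps them bounded away from zero
even for `r = 0`. -/
theorem hasMultiplexingGain_add_mul_logb (r : ℝ) :
    HasMultiplexingGain (fun γ => 1 + r * Real.logb 2 γ) r := by
  have hlog : Tendsto (Real.logb 2) atTop atTop := Real.tendsto_logb_atTop one_lt_two
  have h := (hlog.const_div_atTop 1).add_const r
  rw [zero_add] at h
  refine h.congr' ?_
  filter_upwards [hlog.eventually_gt_atTop 0] with γ hγ
  field_simp

theorem isDataRate_add_mul_logb {r : ℝ} (hr : 0 ≤ r) :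
    IsDataRate (fun γ => 1 + r * Real.logb 2 γ) := by
  refine ⟨1, one_pos, ?_⟩
  filter_upwards [eventually_ge_atTop 1] with γ hγ
  have := Real.logb_nonneg one_lt_two hγ
  nlinarith

theorem max_one_div_mul_le_one_iff {ζ r : ℝ} (hζ₀ : 0 < ζ) (hζ₁ : ζ < 1) (hr : 0 ≤ r) :
    max (1 / ζ) (1 / (1 - ζ)) * r ≤ 1 ↔ r ≤ min ζ (1 - ζ) := by
  rw [max_mul_of_nonneg _ _ hr, max_le_iff, le_min_iff, one_div_mul_eq_div, one_div_mul_eq_div,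
    div_le_one hζ₀, div_le_one (by linarith)]

theorem max_one_div_mul_lt_one_iff {ζ r : ℝ} (hζ₀ : 0 < ζ) (hζ₁ : ζ < 1) (hr : 0 ≤ r) :
    max (1 / ζ) (1 / (1 - ζ)) * r < 1 ↔ r < min ζ (1 - ζ) := by
  rw [max_mul_of_nonneg _ _ hr, max_lt_iff, lt_min_iff, one_div_mul_eq_div, one_div_mul_eq_div,
    div_lt_one hζ₀, div_lt_one (by linarith)]

end Asymptotics

end CoopRelay

theorem mainTheorem2 {Ω : Type*} [MeasurableSpace Ω] (μ : Measure Ω) [IsProbabilityMeasure μ]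
    (M : ℕ) (hM : 3 ≤ M) (h : CoopRelay.Link M → Ω → ℂ) (hh : CoopRelay.IsRayleigh μ h)
    (v : Fin M) (N₀ Ps ζ : ℝ) (hN₀ : 0 < N₀) (hPs : 0 < Ps) (hζ₀ : 0 < ζ) (hζ₁ : ζ < 1) :
    -- at every fixed data rate the outage probability has exact order `γ ^ (-(M - 2))`
    (∀ R₀ : ℝ, 0 < R₀ →
      CoopRelay.outageProb μ h v N₀ Ps ζ (fun _ => R₀) =Θ[atTop]
        fun γ : ℝ => γ ^ (-((M : ℝ) - 2))) ∧
    -- the diversity-multiplexing tradeoff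
    (∀ r : ℝ, 0 ≤ r → r ≤ min ζ (1 - ζ) →
      ∀ R : ℝ → ℝ, CoopRelay.IsDataRate R → CoopRelay.HasMultiplexingGain R r →
        CoopRelay.HasDiversityGain (CoopRelay.outageProb μ h v N₀ Ps ζ R)
          ((1 - max (1 / ζ) (1 / (1 - ζ)) * r) * ((M : ℝ) - 2))) ∧
    -- the maximum diversity gain
    IsGreatest {d : ℝ | ∃ (r : ℝ) (R : ℝ → ℝ), CoopRelay.IsDataRate R ∧
        CoopRelay.HasMultiplexingGain R r ∧
        CoopRelay.HasDiversityGain (CoopRelay.outageProb μ h v N₀ Ps ζ R) d}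
      ((M : ℝ) - 2) ∧
    -- the maximum multiplexing gain
    IsLUB {r : ℝ | ∃ (R : ℝ → ℝ) (d : ℝ), CoopRelay.IsDataRate R ∧
        CoopRelay.HasMultiplexingGain R r ∧ 0 < d ∧
        CoopRelay.HasDiversityGain (CoopRelay.outageProb μ h v N₀ Ps ζ R) d}
      (min ζ (1 - ζ)) := by
  obtain ⟨c, C, hc, hC, hν⟩ := CoopRelay.exists_outageProb_bounds hM hh v hN₀ hPs hζ₀ hζ₁
  have hMn : (M : ℝ) - 2 = ((M - 2 : ℕ) : ℝ) := by
    rw [Nat.cast_sub (by omega), Nat.cast_ofNat]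
  have hn : (0 : ℝ) < ((M - 2 : ℕ) : ℝ) := by exact_mod_cast (by omega : 0 < M - 2)
  have hq : 0 < max (1 / ζ) (1 / (1 - ζ)) := lt_max_of_lt_left (by positivity)
  have hζ : 0 < min ζ (1 - ζ) := lt_min hζ₀ (by linarith)
  rw [hMn]
  have htradeoff : ∀ r : ℝ, 0 ≤ r → r ≤ min ζ (1 - ζ) →
      ∀ R : ℝ → ℝ, CoopRelay.IsDataRate R → CoopRelay.HasMultiplexingGain R r →
        CoopRelay.HasDiversityGain (CoopRelay.outageProb μ h v N₀ Ps ζ R)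
          ((1 - max (1 / ζ) (1 / (1 - ζ)) * r) * ((M - 2 : ℕ) : ℝ)) := fun r hr0 hr R hR hRr =>
    CoopRelay.hasDiversityGain_of_bounds hR hRr hq
      ((CoopRelay.max_one_div_mul_le_one_iff hζ₀ hζ₁ hr0).2 hr) hc hC (hν R)
  refine ⟨fun R₀ hR₀ => ?_, htradeoff, ⟨?_, ?_⟩, ⟨?_, ?_⟩⟩
  · exact CoopRelay.isTheta_of_bounds (mul_pos hq hR₀) hc fun γ hγ => hν (fun _ => R₀) γ hγ hR₀
  · have hR := CoopRelay.isDataRate_add_mul_logb le_rfl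
    have hr := CoopRelay.hasMultiplexingGain_add_mul_logb 0
    refine ⟨0, _, hR, hr, ?_⟩
    simpa using htradeoff 0 le_rfl hζ.le _ hR hr
  · rintro d ⟨r, R, hR, hr, hd⟩
    have hle := hd.le_of_bound hR hr hq hc fun γ h1 h2 => (hν R γ h1 h2).1
    have : max (1 - max (1 / ζ) (1 / (1 - ζ)) * r) 0 ≤ 1 :=
      max_le (by linarith [mul_nonneg hq.le (hr.nonneg hR)]) zero_le_one
    nlinarith
  · rintro r ⟨R, d, hR, hr, hd0, hd⟩
    have hle := hd.le_of_bound hR hr hq hc fun γ h1 h2 => (hν R γ h1 h2).1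
    rw [← CoopRelay.max_one_div_mul_le_one_iff hζ₀ hζ₁ (hr.nonneg hR)]
    by_contra hlt
    rw [max_eq_right (by linarith), mul_zero] at hle
    linarith
  · intro u hu
    -- At `r = min ζ (1 - ζ)` the diversity gain is `0`, so the supremum is approached from below;
    -- `max w 0` handles negative `w`, since the tradeoff requires `r ≥ 0`.
    refine le_of_forall_lt_imp_le_of_dense fun w hw => ?_
    have hr0 : 0 ≤ max w 0 := le_max_right _ _
    have hrlt : max w 0 < min ζ (1 - ζ) := max_lt hw hζ
    have hR := CoopRelay.isDataRate_add_mul_logb hr0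
    have hr := CoopRelay.hasMultiplexingGain_add_mul_logb (max w 0)
    refine (le_max_left w 0).trans (hu ⟨_, _, hR, hr, ?_, htradeoff _ hr0 hrlt.le _ hR hr⟩)
    have := (CoopRelay.max_one_div_mul_lt_one_iff hζ₀ hζ₁ hr0).2 hrlt
    exact mul_pos (by linarith) hn
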